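/- An economy consists of a finite set $I$ of agents, a finite set $O$ of objects, a null object $o^*\notin O$, for each agent $i$ a strict linear order $\succ_i$ on $O\cup\{o^*\}$ (with $x\succsim_i y$ meaning $x=y$ or $x\succ_i y$), and for each object $o$ a nonempty set $C_o\subseteq I$ of owners. An allocation is a map $\mu:I\to O\cup\{o^*\}$ with $|\mu^{-1}(o)|\le 1$ for every $o\in O$. A coalition is a nonempty $C\subseteq I$. For a set $C$ of agents put $\omega(C)=\{o\in O: C_o\subseteq C\}$. A coalition $C$ is self-enforcing in $\sigma$ if $\sigma(C)\subseteq\omega(C)\cup\{o^*\}$, and minimal self-enforcing if moreover no nonempty proper subset of $C$ is self-enforcing in $\sigma$. Put $C_{\sigma=\mu}=\{i\in C:\sigma(i)=\mu(i)\}$. For an allocation $\mu$ put $\Omega(C|\omega,\mu)=\omega(\bigcup_{k\ge0}C^k)$, where $C^0=C$ and $C^{k}=C^{k-1}\cup\mu^{-1}(\omega(C^{k-1}))$. Consider the following conditions on a coalition $C$ and allocations $\mu,\sigma$: (i) $\sigma(i)\succsim_i\mu(i)$ for all $i\in C$ and $\sigma(j)\succ_j\mu(j)$ for some $j\in C$;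 (ii) $C$ is self-enforcing in $\sigma$; (iii) for every coalition $C'\subseteq C_{\sigma=\mu}$ that is self-enforcing in $\sigma$ and every $i\in C\setminus C'$, if $\sigma(i)\in\omega(C')$ then $\sigma(i)\notin\mu(I\setminus C)$; (iv) for all $j\in I$, if $\mu(j)\succ_j\sigma(j)$ then $\mu(j)\in\Omega(C|\omega,\mu)$; (v) if $C_{\sigma=\mu}\ne\emptyset$, then either $C_{\sigma=\mu}$ is self-enforcing in $\sigma$ and $\mu(j)\notin\Omega(C_{\sigma=\mu}|\omega,\mu)$ for all $j$ with $\mu(j)\succ_j\sigma(j)$, or $C$ is minimal self-enforcing in $\sigma$. An allocation $\mu$ is in the strong core if no $C,\sigma$ satisfy (i) and (ii); in the rectified core if no $C,\sigma$ satisfy (i), (ii) and (iii); in the exclusion core if no $C,\sigma$ satisfy (iv) and $\sigma(i)\succ_i\mu(i)$ for all $i\in C$; in the refined exclusion core if no $C,\sigma$ satisfy (i), (iv) and (v). The YRMH-IGYT (``you request my house, I get your turn'') outcomes are the allocations found by the following algorithm for some linear order $\rhd$ of $I$. The current order is initially $\rhd$, and every object initially points to its $\rhd$-highest owner. In each step,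 arcs between remaining agents and objects are maintained, and every remaining object whose pointed agent has been removed now points to its $\rhd$-highest remaining owner, or, if there is none, to its $\rhd$-highest remaining sharing owner, or, if there is none either, to nobody. The highest agent $i$ in the current order then points to her favorite $o$ among the remaining objects and $o^*$. If $o=o^*$ or $o$ points to nobody, $i$ obtains $o$ and both are removed ($o^*$ always remains available). If $o$ points to an agent and a cycle forms, every agent in the cycle obtains the object she points to, and the agents and objects of the cycle are removed; moreover, whenever an agent $j$ of the cycle is an owner or sharing owner of a remaining object $a$, and a remaining agent $j'$ is an owner or sharing owner of an object $b$ of the cycle and is neither an owner nor a sharing owner of $a$, then $j'$ becomes a sharing owner of $a$. If $o$ points to an agent but no cycle forms, that agent is moved to the top of the current order. The algorithm stops when all agents have been removed. Proposition. Suppose that the economy is no-overlapping-ownership: $o\succ_i o^*$ for every agent $i$ and every object $o$, and $C_a\cap C_b=\emptyset$ for all distinct objects $a,b$. Then the set of YRMH-IGYT outcomes, the strong core, the rectified core and the refined exclusion core are all equal, and they are contained in the exclusion core. -/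

import Mathlib

universe u v

/-- An economy with agents `I` and objects `O`. The null object is `none : Option O`.
`pref i x y` says that agent `i` strictly prefers `x` to `y`, and `owners o` is the set of owners
of the object `o`. -/
structure Economy (I : Type u) (O : Type v) where
  pref : I → Option O → Option O → Prop
  pref_linear : ∀ i, IsStrictTotalOrder (Option O) (pref i)
  owners : O → Set I
  owners_nonempty : ∀ o, (owners o).Nonempty

/-- An allocation gives every agent an object or the null object; no object is given to two
agents. Objects may remain unassigned. -/
structure Allocation (I : Type u) (O : Type v) where
  get : I → Option O
  get_inj : ∀ i j o, get i = some o → get j = some o → i = j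

namespace Economy

variable {I : Type u} {O : Type v}

/-- Weak preference: `x` is equal to `y` or strictly preferred to it. -/
def weakPref (E : Economy I O) (i : I) (x y : Option O) : Prop :=
  x = y ∨ E.pref i x y

/-- Every agent strictly prefers every object to the null object. -/
def AllAcceptable (E : Economy I O) : Prop :=
  ∀ (i : I) (o : O), E.pref i (some o) none

/-- No-overlapping-ownership economies: all objects are acceptable to all agents, and distinct
objects have disjoint owner sets. -/
def NoOverlappingOwnership (E : Economy I O) : Prop :=
  E.AllAcceptable ∧ ∀ a b : O, a ≠ b → Disjoint (E.owners a) (E.owners b)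

/-- The endowments of a group of agents. -/
def endow (E : Economy I O) (C : Set I) : Set O :=
  {o | E.owners o ⊆ C}

/-- The group `C` receives only its own endowments and the null object. -/
def SelfEnforcing (E : Economy I O) (C : Set I) (σ : Allocation I O) : Prop :=
  σ.get '' C ⊆ some '' E.endow C ∪ {none}

/-- A self-enforcing coalition without self-enforcing nonempty proper subsets. -/
def MinimalSelfEnforcing (E : Economy I O) (C : Set I) (σ : Allocation I O) : Prop :=
  E.SelfEnforcing C σ ∧ ∀ C' : Set I, C'.Nonempty → C' ⊂ C → ¬ E.SelfEnforcing C' σ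

/-- The members of `C` who receive the same assignment in `σ` and `μ`. -/
def unaffected (C : Set I) (μ σ : Allocation I O) : Set I :=
  {i ∈ C | σ.get i = μ.get i}

/-- No member of `C` is worse off in `σ` than in `μ`, and some member is strictly better off. -/
def Improves (E : Economy I O) (C : Set I) (μ σ : Allocation I O) : Prop :=
  (∀ i ∈ C, E.weakPref i (σ.get i) (μ.get i)) ∧ ∃ j ∈ C, E.pref j (σ.get j) (μ.get j)

/-! ### Strong core and rectified core -/

def WeaklyBlocks (E : Economy I O) (C : Set I) (μ σ : Allocation I O) : Prop :=
  C.Nonempty ∧ E.Improves C μ σ ∧ E.SelfEnforcing C σ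

def strongCore (E : Economy I O) : Set (Allocation I O) :=
  {μ | ¬ ∃ C σ, E.WeaklyBlocks C μ σ}

def RectificationBlocks (E : Economy I O) (C : Set I) (μ σ : Allocation I O) : Prop :=
  C.Nonempty ∧ E.Improves C μ σ ∧ E.SelfEnforcing C σ ∧
    ∀ C' : Set I, C'.Nonempty → C' ⊆ unaffected C μ σ → E.SelfEnforcing C' σ →
      ∀ i ∈ C \ C', σ.get i ∈ some '' E.endow C' → σ.get i ∉ μ.get '' Cᶜ

def rectifiedCore (E : Economy I O) : Set (Allocation I O) :=
  {μ | ¬ ∃ C σ, E.RectificationBlocks C μ σ}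

/-! ### Exclusion core and refined exclusion core -/

/-- `C⁰ = C` and `Cᵏ⁺¹` adds to `Cᵏ` the agents who occupy endowments of `Cᵏ` in `μ`. -/
def controlStage (E : Economy I O) (μ : Allocation I O) (C : Set I) : ℕ → Set I
  | 0 => C
  | k + 1 => controlStage E μ C k ∪ {i | μ.get i ∈ some '' E.endow (controlStage E μ C k)}

/-- The set of objects directly or indirectly controlled by `C` in `μ`. -/
def controlled (E : Economy I O) (μ : Allocation I O) (C : Set I) : Set O :=
  E.endow (⋃ k, E.controlStage μ C k)

def ExclusionBlocks (E : Economy I O) (C : Set I) (μ σ : Allocation I O) : Prop :=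
  C.Nonempty ∧ (∀ i ∈ C, E.pref i (σ.get i) (μ.get i)) ∧
    ∀ j, E.pref j (μ.get j) (σ.get j) → μ.get j ∈ some '' E.controlled μ C

def exclusionCore (E : Economy I O) : Set (Allocation I O) :=
  {μ | ¬ ∃ C σ, E.ExclusionBlocks C μ σ}

def RefinedExclusionBlocks (E : Economy I O) (C : Set I) (μ σ : Allocation I O) : Prop :=
  C.Nonempty ∧ E.Improves C μ σ ∧
    (∀ j, E.pref j (μ.get j) (σ.get j) → μ.get j ∈ some '' E.controlled μ C) ∧
    ((unaffected C μ σ).Nonempty →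
      (E.SelfEnforcing (unaffected C μ σ) σ ∧
        ∀ j, E.pref j (μ.get j) (σ.get j) →
          μ.get j ∉ some '' E.controlled μ (unaffected C μ σ)) ∨
      E.MinimalSelfEnforcing C σ)

def refinedExclusionCore (E : Economy I O) : Set (Allocation I O) :=
  {μ | ¬ ∃ C σ, E.RefinedExclusionBlocks C μ σ}

end Economy

/-! ### The "you request my house - I get your turn" algorithm -/

/-- A state of the algorithm.
* `order`: the remaining agents, listed in the current order, highest first;
* `objs`: the remaining objects;
* `arc i`: the object to which agent `i` currently points (`none` if there is no such object);
* `ptr o`: the agent to whom object `o` currently points, if any;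
* `shared o`: the agents who have obtained shared ownership of `o`;
* `asg i`: the assignment of a removed agent `i` (`none` is the null object). -/
structure YrmhState (I : Type u) (O : Type v) where
  order : List I
  objs : Set O
  arc : I → Option O
  ptr : O → Option I
  shared : O → Set I
  asg : I → Option O

namespace YrmhState

variable {I : Type u} {O : Type v}

open Classical in
/-- The first element of the list `rk` that belongs to `S`, if any. -/
noncomputable def highest (rk : List I) (S : Set I) : Option I :=
  rk.find? (fun i => decide (i ∈ S))

/-- The remaining owners of `o`. -/
def remOwners (E : Economy I O) (s : YrmhState I O) (o : O) : Set I :=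
  {i ∈ E.owners o | i ∈ s.order}

/-- The remaining agents with shared ownership of `o`. -/
def remShared (s : YrmhState I O) (o : O) : Set I :=
  {i ∈ s.shared o | i ∈ s.order}

/-- The initial state for the exogenous order `rk`, listed from the highest agent to the lowest:
every object points to its highest owner. -/
noncomputable def start (E : Economy I O) (rk : List I) : YrmhState I O where
  order := rk
  objs := Set.univ
  arc := fun _ => none
  ptr := fun o => highest rk (E.owners o)
  shared := fun _ => ∅
  asg := fun _ => none

open Classical in
/-- Every object whose pointed agent has been removed now points to its highest remaining owner in
the exogenous order; if there is none, to its highest remaining sharing owner; if there is none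
either, to nobody. All other arcs from objects are maintained. -/
noncomputable def repoint (E : Economy I O) (rk : List I) (s : YrmhState I O) :
    YrmhState I O :=
  { s with
    ptr := fun o =>
      if ∃ j, s.ptr o = some j ∧ j ∉ s.order then
        if (s.remOwners E o).Nonempty then highest rk (s.remOwners E o)
        else highest rk (s.remShared o)
      else s.ptr o }

open Classical in
/-- Let agent `i` point to `x`. -/
noncomputable def point (s : YrmhState I O) (i : I) (x : Option O) : YrmhState I O :=
  { s with arc := Function.update s.arc i x }

/-- The favorite of agent `i` among the remaining objects and the null object is `x`. -/
def IsFavorite (E : Economy I O) (s : YrmhState I O) (i : I) (x : Option O) : Prop :=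
  x ∈ some '' s.objs ∪ {none} ∧ ∀ y ∈ some '' s.objs ∪ {none}, E.weakPref i x y

/-- Agent `i` points to an object that points to agent `j`. -/
def Requests (s : YrmhState I O) (i j : I) : Prop :=
  ∃ o, s.arc i = some o ∧ s.ptr o = some j

/-- Agent `i` lies on a cycle of arcs. -/
def InCycle (s : YrmhState I O) (i : I) : Prop :=
  Relation.TransGen s.Requests i i

/-- The agents on the cycle through `i`. -/
def cycle (s : YrmhState I O) (i : I) : Set I :=
  {k | Relation.TransGen s.Requests i k ∧ Relation.TransGen s.Requests k i}

/-- The objects to which members of `K` point. -/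
def targets (s : YrmhState I O) (K : Set I) : Set O :=
  {o | ∃ k ∈ K, s.arc k = some o}

open Classical in
/-- Every agent in `K` obtains what she points to; these agents and objects are removed, together
with all arcs from agents to removed objects. -/
noncomputable def clear (s : YrmhState I O) (K : Set I) : YrmhState I O :=
  { s with
    order := s.order.filter (fun i => decide (i ∉ K))
    objs := s.objs \ s.targets K
    arc := fun i => if ∃ o ∈ s.targets K, s.arc i = some o then none else s.arc i
    asg := fun i => if i ∈ K then s.arc i else s.asg i }

/-- Sharing ownership after the agents `K` of a cycle trade: each remaining (sharing) owner `j'` of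
an object `b` in the cycle obtains shared ownership of each remaining object `a` that has a
(sharing) owner `j` in the cycle, unless `j'` is already a (sharing) owner of `a`. -/
def share (E : Economy I O) (s : YrmhState I O) (K : Set I) : YrmhState I O :=
  { s with
    shared := fun a =>
      s.shared a ∪
        {j' | a ∈ s.objs \ s.targets K ∧ j' ∉ K ∧
          (∃ j ∈ K, j ∈ s.remOwners E a ∪ s.remShared a) ∧
          (∃ b ∈ s.targets K, j' ∈ s.remOwners E b ∪ s.remShared b) ∧
          j' ∉ s.remOwners E a ∪ s.remShared a} }

open Classical in
/-- Move agent `j` to the top of the current order. -/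
noncomputable def moveTop (s : YrmhState I O) (j : I) : YrmhState I O :=
  { s with order := j :: s.order.filter (fun i => decide (i ≠ j)) }

/-- One step of the algorithm with exogenous order `rk`. First the arcs from objects are updated,
then the highest agent `i` in the current order points to her favorite `x`. -/
inductive Step (E : Economy I O) (rk : List I) (s : YrmhState I O) : YrmhState I O → Prop
  /-- She points to the null object and obtains it. -/
  | takeNull (i : I) (hi : s.order.head? = some i) (hx : s.IsFavorite E i none) :
      Step E rk s (((s.repoint E rk).point i none).clear {i})
  /-- She points to an object that points to nobody and obtains it. -/
  | take (i : I) (o : O) (hi : s.order.head? = some i) (hx : s.IsFavorite E i (some o))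
      (ho : (s.repoint E rk).ptr o = none) :
      Step E rk s (((s.repoint E rk).point i (some o)).clear {i})
  /-- A cycle forms: its members trade and are removed, and ownership is shared. -/
  | trade (i : I) (o : O) (j : I) (t : YrmhState I O) (K : Set I)
      (hi : s.order.head? = some i) (hx : s.IsFavorite E i (some o))
      (ht : t = (s.repoint E rk).point i (some o))
      (ho : t.ptr o = some j) (hc : t.InCycle i) (hK : K = t.cycle i) :
      Step E rk s ((t.share E K).clear K)
  /-- The object points to an agent `j` but no cycle forms: `j` moves to the top. -/
  | move (i : I) (o : O) (j : I) (t : YrmhState I O)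
      (hi : s.order.head? = some i) (hx : s.IsFavorite E i (some o))
      (ht : t = (s.repoint E rk).point i (some o))
      (ho : t.ptr o = some j) (hc : ¬ t.InCycle i) :
      Step E rk s (t.moveTop j)

end YrmhState

/-- The outcomes of the algorithm: the allocations reached, for some linear order `rk` of all
agents, when the algorithm started at `rk` has removed all agents. -/
def Economy.yrmhOutcomes {I : Type u} {O : Type v} (E : Economy I O) :
    Set (Allocation I O) :=
  {μ | ∃ rk : List I, rk.Nodup ∧ (∀ i, i ∈ rk) ∧
    ∃ s : YrmhState I O,
      Relation.ReflTransGen (YrmhState.Step E rk) (YrmhState.start E rk) s ∧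
      s.order = [] ∧ ∀ i, μ.get i = s.asg i}

/-! ### Preferences, disjoint ownership and representative owners. -/

namespace Economy

variable {I : Type u} {O : Type v} {E : Economy I O}

/-! Because owner sets are disjoint, a choice of one owner `r o` for each object is injective. The
proof shows that the allocations in question are those produced by top trading cycles among such
representatives (`IsTopTrading`). Its main tool is a counting argument,
`Allocation.eq_rep_of_closed`: if the representatives of a set of objects all receive objects of
that set, they exhaust it, and nobody else gets any of it.

Top trading allocations resist weak blocks and refined exclusion blocks by induction on the round:
anything better than an assignment was traded earlier and is still held by those who traded it.

In the algorithm the representative of an object is its highest owner. She leaves exactly when the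
object does, so ownership is never shared and each outcome is top trading (`Inv.step`). Conversely,
a strong core allocation gives objects to exactly one owner of each object. If these owners are
ranked first, every cycle carries out that allocation; otherwise its members, joined by the other
owners of their objects, would block (`IsTrade.arc_eq`).

For the other inclusions, let a weak block be given. If all owners of some object receive nothing,
giving it to one of them blocks in each required sense. Otherwise counting turns the weak block into
a rectification block and, once the members who keep the same object are dropped, into a refined
exclusion block. -/

theorem pref_irrefl (E : Economy I O) (i : I) (x : Option O) : ¬ E.pref i x x := by
  have := E.pref_linear i
  exact irrefl_of (E.pref i) x

theorem pref_asymm {i : I} {x y : Option O} (h : E.pref i x y) : ¬ E.pref i y x := by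
  have := E.pref_linear i
  exact asymm_of (E.pref i) h

theorem pref_or_eq_or_pref (E : Economy I O) (i : I) (x y : Option O) :
    E.pref i x y ∨ x = y ∨ E.pref i y x := by
  have := E.pref_linear i
  exact trichotomous_of (E.pref i) x y

theorem weakPref.not_pref {i : I} {x y : Option O} (h : E.weakPref i x y) : ¬ E.pref i y x := by
  rcases h with rfl | h
  · exact E.pref_irrefl i x
  · exact pref_asymm h

theorem weakPref.pref_of_ne {i : I} {x y : Option O} (h : E.weakPref i x y) (hne : x ≠ y) :
    E.pref i x y :=
  h.resolve_left hne

theorem AllAcceptable.ne_none_of_pref (hA : E.AllAcceptable) {i : I} {x y : Option O}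
    (h : E.pref i x y) : x ≠ none := by
  rintro rfl
  rcases y with _ | o
  · exact E.pref_irrefl i _ h
  · exact pref_asymm h (hA i o)

theorem AllAcceptable.ne_none_of_weakPref (hA : E.AllAcceptable) {i : I} {x y : Option O}
    (h : E.weakPref i x y) (hy : y ≠ none) : x ≠ none := by
  rcases h with rfl | h
  · exact hy
  · exact hA.ne_none_of_pref h

/-- Every finite nonempty set of options contains a favorite. -/
theorem exists_favorite [Finite O] (E : Economy I O) (i : I) {S : Set (Option O)}
    (hS : S.Nonempty) : ∃ x ∈ S, ∀ y ∈ S, E.weakPref i x y := by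
  have := E.pref_linear i
  have hwf : WellFounded (E.pref i) := Finite.wellFounded_of_trans_of_irrefl _
  obtain ⟨x, hx, hmin⟩ := hwf.has_min S hS
  refine ⟨x, hx, fun y hy => ?_⟩
  rcases E.pref_or_eq_or_pref i x y with h | h | h
  · exact Or.inr h
  · exact Or.inl h
  · exact absurd h (hmin y hy)

theorem NoOverlappingOwnership.eq_of_mem_owners (hE : E.NoOverlappingOwnership) {i : I} {a b : O}
    (ha : i ∈ E.owners a) (hb : i ∈ E.owners b) : a = b := by
  by_contra hne
  exact Set.disjoint_left.mp (hE.2 a b hne) ha hb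

theorem some_mem_image_endow {o : O} {C : Set I} :
    some o ∈ some '' E.endow C ↔ E.owners o ⊆ C := by
  simp [endow]

theorem selfEnforcing_iff {C : Set I} {σ : Allocation I O} :
    E.SelfEnforcing C σ ↔ ∀ i ∈ C, ∀ o, σ.get i = some o → E.owners o ⊆ C := by
  constructor
  · intro h i hi o ho
    rcases h ⟨i, hi, ho⟩ with h | h
    · exact some_mem_image_endow.mp h
    · cases h
  · rintro h _ ⟨i, hi, rfl⟩
    rcases ho : σ.get i with _ | o
    · exact Or.inr rfl
    · exact Or.inl (some_mem_image_endow.mpr (h i hi o ho))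

/-- A choice of one owner of each object is injective. -/
theorem NoOverlappingOwnership.rep_injective (hE : E.NoOverlappingOwnership) {r : O → I}
    (hr : ∀ o, r o ∈ E.owners o) : Function.Injective r := fun a b h =>
  hE.eq_of_mem_owners (hr a) (h ▸ hr b)

end Economy

/-- If the representatives of a finite set of objects receive objects of that set, then they
receive all of them. -/
theorem Allocation.eq_rep_of_closed {I : Type u} {O : Type v} [Finite O] (σ : Allocation I O)
    {r : O → I} (hr : Function.Injective r) {S : Set O}
    (hS : ∀ y ∈ S, ∃ z ∈ S, σ.get (r y) = some z) {x : O} (hx : x ∈ S) {i : I}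
    (hi : σ.get i = some x) : ∃ y ∈ S, i = r y := by
  choose! f hf hσ using hS
  have hinj : Function.Injective (fun y : S => (⟨f y, hf y y.2⟩ : S)) := by
    intro a b hab
    have h : f a = f b := congrArg Subtype.val hab
    exact Subtype.ext (hr (σ.get_inj _ _ _ (hσ a a.2) (h ▸ hσ b b.2)))
  obtain ⟨y, hy⟩ := Finite.surjective_of_injective hinj ⟨x, hx⟩
  have hy' : f y = x := congrArg Subtype.val hy
  exact ⟨y, y.2, σ.get_inj _ _ _ hi (hy' ▸ hσ y y.2)⟩

namespace Economy

variable {I : Type u} {O : Type v} {E : Economy I O}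

/-! ### Top trading allocations -/

/-- One owner `r o` of each object `o` receives an object, and these agents trade in successive
rounds: `ρ o` is the round in which `o` is traded, and an object that `r o` prefers to her
assignment is traded earlier. -/
structure IsTopTrading (E : Economy I O) (μ : Allocation I O) (r : O → I) (ρ : O → ℕ) : Prop where
  rep_mem : ∀ o, r o ∈ E.owners o
  eq_rep : ∀ i, μ.get i ≠ none → ∃ o, i = r o
  get_rep : ∀ o, ∃ o', μ.get (r o) = some o' ∧ ρ o' = ρ o
  rank_lt : ∀ o x, E.pref (r o) (some x) (μ.get (r o)) → ρ x < ρ o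

/-- Representatives in `C` cannot gain: a better `x` was traded in an earlier round, and by
induction the objects of that round owned within `C` still go to their own representatives. With
these fixed, counting also makes the improving member a representative. -/
theorem IsTopTrading.not_weaklyBlocks [Finite O] (hE : E.NoOverlappingOwnership)
    {μ : Allocation I O} {r : O → I} {ρ : O → ℕ} (h : E.IsTopTrading μ r ρ) (C : Set I)
    (σ : Allocation I O) : ¬ E.WeaklyBlocks C μ σ := by
  rintro ⟨-, ⟨hw, j, hjC, hj⟩, hself⟩
  rw [selfEnforcing_iff] at hself
  have hinj := hE.rep_injective h.rep_mem
  have key : ∀ n o, ρ o = n → r o ∈ C → σ.get (r o) = μ.get (r o) := by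
    intro n
    induction n using Nat.strong_induction_on with
    | _ n ih =>
      intro o hn ho
      by_contra hne
      have hp := (hw _ ho).pref_of_ne hne
      obtain ⟨x, hx⟩ := Option.ne_none_iff_exists'.mp (hE.1.ne_none_of_pref hp)
      rw [hx] at hp
      have hlt := h.rank_lt o x hp
      obtain ⟨y, ⟨-, hy⟩, hoy⟩ := σ.eq_rep_of_closed hinj
        (S := {y | E.owners y ⊆ C ∧ ρ y = ρ x}) (fun y hy => by
          have hyC := hy.1 (h.rep_mem y)
          obtain ⟨z, hz, hρ⟩ := h.get_rep y
          have hσ := ih _ (hn ▸ hlt) y hy.2 hyC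
          exact ⟨z, ⟨hself _ hyC z (hσ.trans hz), hρ.trans hy.2⟩, hσ.trans hz⟩)
        ⟨hself _ ho x hx, rfl⟩ hx
      have := hinj hoy
      subst this
      omega
  obtain ⟨x, hx⟩ := Option.ne_none_iff_exists'.mp (hE.1.ne_none_of_pref hj)
  obtain ⟨y, -, hjy⟩ := σ.eq_rep_of_closed hinj (S := {y | E.owners y ⊆ C}) (fun y hy => by
      have hyC := hy (h.rep_mem y)
      obtain ⟨z, hz, -⟩ := h.get_rep y
      have hσ := key _ y rfl hyC
      exact ⟨z, hself _ hyC z (hσ.trans hz), hσ.trans hz⟩) (hself _ hjC x hx) hx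
  subst hjy
  rw [key _ y rfl hjC] at hj
  exact E.pref_irrefl _ _ hj

theorem IsTopTrading.not_refinedExclusionBlocks [Finite O] (hE : E.NoOverlappingOwnership)
    {μ : Allocation I O} {r : O → I} {ρ : O → ℕ} (h : E.IsTopTrading μ r ρ) (C : Set I)
    (σ : Allocation I O) : ¬ E.RefinedExclusionBlocks C μ σ := by
  rintro ⟨hC, himp, hcon, hun⟩
  have hw := himp.1
  have hinj := hE.rep_injective h.rep_mem
  -- If (v) holds through minimality, `C` is self-enforcing and hence a weak block, which is already
  -- excluded.
  have hU : E.SelfEnforcing (unaffected C μ σ) σ := by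
    rcases (unaffected C μ σ).eq_empty_or_nonempty with he | hne
    · rw [he]
      simp [SelfEnforcing]
    · rcases hun hne with hu | hu
      · exact hu.1
      · exact absurd ⟨hC, himp, hu.1⟩ (h.not_weaklyBlocks hE C σ)
  rw [selfEnforcing_iff] at hU
  have key : ∀ n o, ρ o = n → σ.get (r o) = μ.get (r o) := by
    intro n
    induction n using Nat.strong_induction_on with
    | _ n ih =>
      have hnot : ∀ o, ρ o = n → ¬ E.pref (r o) (σ.get (r o)) (μ.get (r o)) := by
        intro o hn hp
        obtain ⟨x, hx⟩ := Option.ne_none_iff_exists'.mp (hE.1.ne_none_of_pref hp)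
        rw [hx] at hp
        have hlt := h.rank_lt o x hp
        obtain ⟨y, hy, hoy⟩ := σ.eq_rep_of_closed hinj (S := {y | ρ y = ρ x}) (fun y hy => by
            obtain ⟨z, hz, hρ⟩ := h.get_rep y
            exact ⟨z, hρ.trans hy, (ih _ (hn ▸ hlt) y hy).trans hz⟩) rfl hx
        have := hinj hoy
        subst this
        exact hlt.ne' hy
      -- Within the current round control never spreads beyond the unaffected members: their objects
      -- are closed under trade, so by counting whoever occupies one of them is unaffected too.
      have hstage : ∀ m o, ρ o = n → r o ∈ E.controlStage μ C m →
          r o ∈ unaffected C μ σ := by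
        intro m
        induction m with
        | zero =>
          intro o hn ho
          exact ⟨ho, (hw _ ho).resolve_right (hnot o hn)⟩
        | succ m ihm =>
          rintro o hn (ho | ho)
          · exact ihm o hn ho
          · obtain ⟨a, ha, hρ⟩ := h.get_rep o
            have ho : μ.get (r o) ∈ some '' E.endow (E.controlStage μ C m) := ho
            rw [ha, some_mem_image_endow] at ho
            have haU := ihm a (hρ.trans hn) (ho (h.rep_mem a))
            obtain ⟨y, hy, hoy⟩ := μ.eq_rep_of_closed hinj
              (S := {y | r y ∈ unaffected C μ σ}) (fun y hy => by
                obtain ⟨z, hz, -⟩ := h.get_rep y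
                exact ⟨z, hU _ hy z (hy.2.trans hz) (h.rep_mem z), hz⟩) haU ha
            rw [hoy]
            exact hy
      intro o hn
      rcases E.pref_or_eq_or_pref (r o) (σ.get (r o)) (μ.get (r o)) with hp | he | hp
      · exact absurd hp (hnot o hn)
      · exact he
      · exfalso
        have hc := hcon _ hp
        obtain ⟨a, ha, hρ⟩ := h.get_rep o
        rw [ha] at hc
        have hc : E.owners a ⊆ ⋃ k, E.controlStage μ C k := some_mem_image_endow.mp hc
        obtain ⟨m, hm⟩ := Set.mem_iUnion.mp (hc (h.rep_mem a))
        have haU := hstage m a (hρ.trans hn) hm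
        obtain ⟨y, hy, hoy⟩ := μ.eq_rep_of_closed hinj
          (S := {y | r y ∈ unaffected C μ σ}) (fun y hy => by
            obtain ⟨z, hz, -⟩ := h.get_rep y
            exact ⟨z, hU _ hy z (hy.2.trans hz) (h.rep_mem z), hz⟩) haU ha
        have hy : r y ∈ unaffected C μ σ := hy
        rw [hoy] at hp
        exact (hw _ hy.1).not_pref hp
  obtain ⟨j, hjC, hj⟩ := himp.2
  obtain ⟨x, hx⟩ := Option.ne_none_iff_exists'.mp (hE.1.ne_none_of_pref hj)
  obtain ⟨y, -, hjy⟩ := σ.eq_rep_of_closed hinj (S := Set.univ) (fun y _ => by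
      obtain ⟨z, hz, -⟩ := h.get_rep y
      exact ⟨z, trivial, (key _ y rfl).trans hz⟩) trivial hx
  subst hjy
  rw [key _ y rfl] at hj
  exact E.pref_irrefl _ _ hj

end Economy

/-! ### Auxiliary allocations and controlled objects. -/

namespace Allocation

variable {I : Type u} {O : Type v}

open Classical in
/-- The allocation in which `k` receives `a` and all others receive nothing. -/
noncomputable def single (k : I) (a : O) : Allocation I O where
  get i := if i = k then some a else none
  get_inj i j o hi hj := by
    split_ifs at hi hj with h₁ h₂
    exact h₁.trans h₂.symm

open Classical in
/-- The members of `C` receive their assignments in `σ`, and all others keep their assignments in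
`μ` as far as these remain available. -/
noncomputable def merge (C : Set I) (σ μ : Allocation I O) : Allocation I O where
  get i := if i ∈ C then σ.get i else if ∃ j ∈ C, σ.get j = μ.get i then none else μ.get i
  get_inj i j o hi hj := by
    split_ifs at hi hj with h₁ h₂ h₃ h₄ h₅ h₆
    · exact σ.get_inj _ _ _ hi hj
    · exact absurd ⟨i, h₁, hi.trans hj.symm⟩ h₃
    · exact absurd ⟨j, h₅, hj.trans hi.symm⟩ h₄
    · exact μ.get_inj _ _ _ hi hj

theorem merge_get_of_mem {C : Set I} (σ μ : Allocation I O) {i : I} (hi : i ∈ C) :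
    (merge C σ μ).get i = σ.get i := if_pos hi

end Allocation

namespace Economy

variable {I : Type u} {O : Type v} {E : Economy I O}

/-- Agents outside `C` are only hurt by a merged allocation if they lose their objects to `C`. -/
theorem exists_of_pref_merge {C : Set I} {σ μ : Allocation I O} {j : I} (hj : j ∉ C)
    (hp : E.pref j (μ.get j) ((Allocation.merge C σ μ).get j)) :
    ∃ i ∈ C, σ.get i = μ.get j := by
  by_contra hne
  rw [show (Allocation.merge C σ μ).get j = μ.get j by
    simp only [Allocation.merge, if_neg hj, if_neg hne]] at hp
  exact E.pref_irrefl _ _ hp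

/-- An object has finitely many owners, so a single stage contains them all and the next stage adds
the occupant. -/
theorem mem_controlStage_iUnion [Finite I] {μ : Allocation I O} {C : Set I} {i : I} {o : O}
    (hi : μ.get i = some o) (ho : o ∈ E.controlled μ C) : i ∈ ⋃ k, E.controlStage μ C k := by
  have hmono : Monotone (E.controlStage μ C) :=
    monotone_nat_of_le_succ fun k => Set.subset_union_left
  have ho : E.owners o ⊆ ⋃ k, E.controlStage μ C k := ho
  choose! f hf using fun x (hx : x ∈ E.owners o) => Set.mem_iUnion.mp (ho hx)
  obtain ⟨N, hN⟩ := (Set.finite_range f).bddAbove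
  refine Set.mem_iUnion.mpr ⟨N + 1, Or.inr ?_⟩
  change μ.get i ∈ some '' E.endow (E.controlStage μ C N)
  rw [hi, some_mem_image_endow]
  exact fun x hx => hmono (hN ⟨x, rfl⟩) (hf x hx)

theorem controlled_eq_empty {μ : Allocation I O} {C : Set I} (hC : ∀ o, ¬ E.owners o ⊆ C) :
    E.controlled μ C = ∅ := by
  have hstage : ∀ k, E.controlStage μ C k = C := by
    intro k
    induction k with
    | zero => rfl
    | succ k ih =>
      refine (congrArg (fun D => D ∪ {i | μ.get i ∈ some '' E.endow D}) ih).trans ?_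
      refine Set.union_eq_self_of_subset_right ?_
      rintro i ⟨o, ho, -⟩
      exact absurd ho (hC o)
  ext o
  simp [controlled, endow, hstage, Set.iUnion_const, hC o]

theorem subset_controlled {μ : Allocation I O} {C : Set I} {o : O} (h : E.owners o ⊆ C) :
    o ∈ E.controlled μ C :=
  fun _ hx => Set.mem_iUnion.mpr ⟨0, h hx⟩

/-! ### Objects all of whose owners receive nothing -/

section Single

variable {μ : Allocation I O} {a : O} {k : I}

theorem improves_single (hA : E.AllAcceptable) (ha : ∀ i ∈ E.owners a, μ.get i = none)
    (hk : k ∈ E.owners a) : E.Improves (E.owners a) μ (Allocation.single k a) := by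
  refine ⟨fun i hi => ?_, k, hk, ?_⟩
  · rw [ha i hi]
    by_cases h : i = k
    · simpa [Allocation.single, weakPref, h] using hA k a
    · simp [Allocation.single, weakPref, h]
  · rw [ha k hk]
    simpa [Allocation.single] using hA k a

theorem selfEnforcing_single : E.SelfEnforcing (E.owners a) (Allocation.single k a) := by
  rw [selfEnforcing_iff]
  intro i _ o ho
  by_cases h : i = k <;> simp [Allocation.single, h] at ho
  rw [ho]

theorem weaklyBlocks_single (hA : E.AllAcceptable) (ha : ∀ i ∈ E.owners a, μ.get i = none)
    (hk : k ∈ E.owners a) : E.WeaklyBlocks (E.owners a) μ (Allocation.single k a) :=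
  ⟨⟨k, hk⟩, improves_single hA ha hk, selfEnforcing_single⟩

/-- A group of unaffected agents owns nothing if all owners of `a` received nothing. -/
theorem not_owners_subset_unaffected (hE : E.NoOverlappingOwnership)
    (ha : ∀ i ∈ E.owners a, μ.get i = none) (hk : k ∈ E.owners a) {σ : Allocation I O}
    (hσ : σ.get k = some a) (o : O) : ¬ E.owners o ⊆ unaffected (E.owners a) μ σ := by
  intro h
  obtain ⟨x, hx⟩ := E.owners_nonempty o
  have := hE.eq_of_mem_owners hx (h hx).1
  subst this
  have := (h hk).2
  rw [hσ, ha k hk] at this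
  cases this

/-- Condition (iii) is vacuous, since groups of unaffected agents have no endowments. -/
theorem rectificationBlocks_single (hE : E.NoOverlappingOwnership)
    (ha : ∀ i ∈ E.owners a, μ.get i = none) (hk : k ∈ E.owners a) :
    E.RectificationBlocks (E.owners a) μ (Allocation.single k a) := by
  refine ⟨⟨k, hk⟩, improves_single hE.1 ha hk, selfEnforcing_single, ?_⟩
  rintro C' - hC' - i - ⟨o, ho, -⟩
  exact absurd (Set.Subset.trans ho hC')
    (not_owners_subset_unaffected hE ha hk (by simp [Allocation.single]) o)

/-- Merging with `μ` hurts at most the agent who occupied `a`, which the coalition controls. The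
unaffected members receive nothing and control nothing, so the first alternative of (v) holds. -/
theorem refinedExclusionBlocks_single (hE : E.NoOverlappingOwnership)
    (ha : ∀ i ∈ E.owners a, μ.get i = none) (hk : k ∈ E.owners a) :
    E.RefinedExclusionBlocks (E.owners a) μ
      (Allocation.merge (E.owners a) (Allocation.single k a) μ) := by
  have himp := improves_single hE.1 ha hk
  have hget : ∀ i ∈ E.owners a, (Allocation.merge (E.owners a) (Allocation.single k a) μ).get i =
      (Allocation.single k a).get i := fun i => Allocation.merge_get_of_mem _ _
  have himp' : E.Improves (E.owners a) μ
      (Allocation.merge (E.owners a) (Allocation.single k a) μ) := by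
    refine ⟨fun i hi => ?_, ?_⟩
    · rw [hget i hi]
      exact himp.1 i hi
    · obtain ⟨j, hj, hp⟩ := himp.2
      exact ⟨j, hj, by rwa [hget j hj]⟩
  refine ⟨⟨k, hk⟩, himp', ?_, fun _ => Or.inl ⟨?_, ?_⟩⟩
  · intro j hj
    have hjC : j ∉ E.owners a := fun h => (himp'.1 j h).not_pref hj
    obtain ⟨i, hi, hij⟩ := exists_of_pref_merge hjC hj
    obtain ⟨o, ho⟩ := Option.ne_none_iff_exists'.mp (hE.1.ne_none_of_pref hj)
    rw [ho]
    exact ⟨o, subset_controlled (selfEnforcing_iff.mp selfEnforcing_single i hi o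
      (hij.trans ho)), rfl⟩
  · rw [selfEnforcing_iff]
    intro i hi o ho
    rw [hi.2, ha i hi.1] at ho
    cases ho
  · intro j _
    rw [controlled_eq_empty (not_owners_subset_unaffected hE ha hk
      (by rw [hget k hk]; simp [Allocation.single]))]
    simp

end Single

/-! ### Blocks when every object has an owner who receives an object -/

section Represented

variable {μ σ : Allocation I O} {r : O → I} {C : Set I}

/-- Supplies the closure hypothesis of `Allocation.eq_rep_of_closed` for the endowments of `C`. -/
theorem SelfEnforcing.exists_get_rep (hA : E.AllAcceptable) (hself : E.SelfEnforcing C σ)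
    (hr : ∀ o, r o ∈ E.owners o) (hμ : ∀ o, μ.get (r o) ≠ none)
    (hw : ∀ i ∈ C, E.weakPref i (σ.get i) (μ.get i)) {y : O} (hy : E.owners y ⊆ C) :
    ∃ z, E.owners z ⊆ C ∧ σ.get (r y) = some z := by
  have hyC := hy (hr y)
  obtain ⟨z, hz⟩ := Option.ne_none_iff_exists'.mp (hA.ne_none_of_weakPref (hw _ hyC) (hμ y))
  exact ⟨z, selfEnforcing_iff.mp hself _ hyC z hz, hz⟩

/-- Condition (iii) is vacuous: by counting, the endowments of `C'` all go to representatives inside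
`C'`. -/
theorem rectificationBlocks_of_weaklyBlocks [Finite O] (hE : E.NoOverlappingOwnership)
    (hr : ∀ o, r o ∈ E.owners o) (hμ : ∀ o, μ.get (r o) ≠ none) (h : E.WeaklyBlocks C μ σ) :
    E.RectificationBlocks C μ σ := by
  obtain ⟨hne, himp, hself⟩ := h
  refine ⟨hne, himp, hself, ?_⟩
  rintro C' - hC' hself' i ⟨-, hi⟩ ⟨o, ho, hio⟩
  obtain ⟨y, hy, rfl⟩ := σ.eq_rep_of_closed (hE.rep_injective hr) (S := {y | E.owners y ⊆ C'})
    (fun y hy => hself'.exists_get_rep hE.1 hr hμ (fun i hi => himp.1 i (hC' hi).1) hy) ho hio.symm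
  exact absurd (hy (hr y)) hi

/-- Dropping the members who keep the same object leaves only unaffected members with nothing, which
gives (v). The dropped members are recovered through indirect control where (iv) needs them. -/
theorem refinedExclusionBlocks_of_weaklyBlocks [Finite I] [Finite O]
    (hE : E.NoOverlappingOwnership) (hr : ∀ o, r o ∈ E.owners o) (hμ : ∀ o, μ.get (r o) ≠ none)
    (h : E.WeaklyBlocks C μ σ) :
    E.RefinedExclusionBlocks {c ∈ C | μ.get c = σ.get c → μ.get c = none} μ
      (Allocation.merge C σ μ) := by
  obtain ⟨-, ⟨hw, j, hjC, hj⟩, hself⟩ := h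
  set D : Set I := {c ∈ C | μ.get c = σ.get c → μ.get c = none} with hD
  have hinj := hE.rep_injective hr
  have hget : ∀ i ∈ C, (Allocation.merge C σ μ).get i = σ.get i :=
    fun i => Allocation.merge_get_of_mem _ _
  have hjD : j ∈ D := ⟨hjC, fun h => absurd (h ▸ hj) (E.pref_irrefl _ _)⟩
  have hU : ∀ i ∈ unaffected D μ (Allocation.merge C σ μ), μ.get i = none := fun i hi =>
    hi.1.2 ((hget i hi.1.1).symm.trans hi.2).symm
  have hrep : ∀ c ∈ C, σ.get c ≠ none → ∃ y, c = r y := by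
    intro c hc hne
    obtain ⟨x, hx⟩ := Option.ne_none_iff_exists'.mp hne
    obtain ⟨y, -, hy⟩ := σ.eq_rep_of_closed hinj (S := {y | E.owners y ⊆ C})
      (fun y hy => hself.exists_get_rep hE.1 hr hμ hw hy) (selfEnforcing_iff.mp hself c hc x hx) hx
    exact ⟨y, hy⟩
  -- Owners other than the representative receive nothing in `σ`, so control of an endowment of `C`
  -- depends only on its representative.
  have hother : ∀ o, E.owners o ⊆ C → ∀ c ∈ E.owners o, c ≠ r o → c ∈ D := by
    refine fun o ho c hc hne => ⟨ho hc, fun heq => ?_⟩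
    by_contra hcn
    obtain ⟨y, rfl⟩ := hrep c (ho hc) (heq ▸ hcn)
    exact hne (congrArg r (hE.eq_of_mem_owners (hr y) hc))
  -- The endowments of `C` outside the control of `D` are closed under trade, and `μ` and `σ` agree
  -- on their representatives. An outsider therefore cannot lose such an object.
  have hctrl : ∀ o, E.owners o ⊆ C → o ∉ E.controlled μ D →
      ∃ z, (E.owners z ⊆ C ∧ z ∉ E.controlled μ D) ∧
        μ.get (r o) = some z ∧ σ.get (r o) = some z := by
    intro o ho hnot
    have hstep : r o ∉ ⋃ k, E.controlStage μ D k := by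
      intro hro
      refine hnot fun c hc => ?_
      by_cases hcr : c = r o
      · exact hcr ▸ hro
      · exact Set.mem_iUnion.mpr ⟨0, hother o ho c hc hcr⟩
    have heq : μ.get (r o) = σ.get (r o) := by
      by_contra hne
      exact hstep (Set.mem_iUnion.mpr ⟨0, ho (hr o), fun h => absurd h hne⟩)
    obtain ⟨z, hz, hσ⟩ := hself.exists_get_rep hE.1 hr hμ hw ho
    exact ⟨z, ⟨hz, fun hzc => hstep (mem_controlStage_iUnion (heq.trans hσ) hzc)⟩,
      heq.trans hσ, hσ⟩
  refine ⟨⟨j, hjD⟩, ⟨fun i hi => ?_, j, hjD, ?_⟩, ?_, fun _ => Or.inl ⟨?_, ?_⟩⟩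
  · rw [hget i hi.1]
    exact hw i hi.1
  · rwa [hget j hjC]
  · intro l hl
    have hlC : l ∉ C := fun h => by
      rw [hget l h] at hl
      exact (hw l h).not_pref hl
    obtain ⟨i, hi, hil⟩ := exists_of_pref_merge hlC hl
    obtain ⟨o, ho⟩ := Option.ne_none_iff_exists'.mp (hE.1.ne_none_of_pref hl)
    rw [ho] at hil ⊢
    by_contra hnot
    have hnot : o ∉ E.controlled μ D := fun h => hnot ⟨o, h, rfl⟩
    obtain ⟨y, hy, rfl⟩ := σ.eq_rep_of_closed hinj
      (S := {y | E.owners y ⊆ C ∧ y ∉ E.controlled μ D}) (fun y hy => by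
        obtain ⟨z, hz, -, hσ⟩ := hctrl y hy.1 hy.2
        exact ⟨z, hz, hσ⟩) ⟨selfEnforcing_iff.mp hself i hi o hil, hnot⟩ hil
    obtain ⟨z, -, hμz, hσz⟩ := hctrl y hy.1 hy.2
    exact hlC (μ.get_inj _ _ _ (hμz.trans (hσz.symm.trans hil)) ho ▸ hi)
  · rw [selfEnforcing_iff]
    intro i hi o ho
    rw [hi.2, hU i hi] at ho
    cases ho
  · intro l _
    rw [controlled_eq_empty fun o ho => hμ o (hU _ (ho (hr o)))]
    simp

end Represented

/-! ### Comparison of the cores. -/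

theorem exists_rep_or_unassigned (E : Economy I O) (μ : Allocation I O) :
    (∃ r : O → I, (∀ o, r o ∈ E.owners o) ∧ ∀ o, μ.get (r o) ≠ none) ∨
      ∃ a, ∀ i ∈ E.owners a, μ.get i = none := by
  by_cases h : ∃ a, ∀ i ∈ E.owners a, μ.get i = none
  · exact Or.inr h
  · push Not at h
    choose r hr hμ using h
    exact Or.inl ⟨r, hr, hμ⟩

theorem strongCore_eq_rectifiedCore [Finite O] (hE : E.NoOverlappingOwnership) :
    E.strongCore = E.rectifiedCore := by
  ext μ
  refine not_congr ⟨?_, ?_⟩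
  · rintro ⟨C, σ, h⟩
    rcases E.exists_rep_or_unassigned μ with ⟨r, hr, hμ⟩ | ⟨a, ha⟩
    · exact ⟨C, σ, rectificationBlocks_of_weaklyBlocks hE hr hμ h⟩
    · obtain ⟨k, hk⟩ := E.owners_nonempty a
      exact ⟨_, _, rectificationBlocks_single hE ha hk⟩
  · rintro ⟨C, σ, h⟩
    exact ⟨C, σ, h.1, h.2.1, h.2.2.1⟩

theorem refinedExclusionCore_subset_strongCore [Finite I] [Finite O]
    (hE : E.NoOverlappingOwnership) : E.refinedExclusionCore ⊆ E.strongCore := by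
  rintro μ hμc ⟨C, σ, h⟩
  rcases E.exists_rep_or_unassigned μ with ⟨r, hr, hμ⟩ | ⟨a, ha⟩
  · exact hμc ⟨_, _, refinedExclusionBlocks_of_weaklyBlocks hE hr hμ h⟩
  · obtain ⟨k, hk⟩ := E.owners_nonempty a
    exact hμc ⟨_, _, refinedExclusionBlocks_single hE ha hk⟩

theorem refinedExclusionCore_subset_exclusionCore :
    E.refinedExclusionCore ⊆ E.exclusionCore := by
  rintro μ hμ ⟨C, σ, ⟨j, hj⟩, hpref, hcon⟩
  refine hμ ⟨C, σ, ⟨j, hj⟩, ⟨fun i hi => Or.inr (hpref i hi), j, hj, hpref j hj⟩, hcon, ?_⟩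
  rintro ⟨i, hi, hσ⟩
  have := hpref i hi
  rw [hσ] at this
  exact absurd this (E.pref_irrefl _ _)

/-- In a strong core allocation, the agents who receive objects are one owner of each object. -/
theorem exists_rep_of_mem_strongCore [Finite O] (hE : E.NoOverlappingOwnership)
    {μ : Allocation I O} (hμ : μ ∈ E.strongCore) :
    ∃ r : O → I, (∀ o, r o ∈ E.owners o) ∧ (∀ o, μ.get (r o) ≠ none) ∧
      ∀ i, μ.get i ≠ none → ∃ o, i = r o := by
  rcases E.exists_rep_or_unassigned μ with ⟨r, hr, hne⟩ | ⟨a, ha⟩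
  · refine ⟨r, hr, hne, fun i hi => ?_⟩
    obtain ⟨x, hx⟩ := Option.ne_none_iff_exists'.mp hi
    obtain ⟨y, -, hy⟩ := μ.eq_rep_of_closed (hE.rep_injective hr) (S := Set.univ) (fun y _ => by
      obtain ⟨z, hz⟩ := Option.ne_none_iff_exists'.mp (hne y)
      exact ⟨z, trivial, hz⟩) trivial hx
    exact ⟨y, hy⟩
  · obtain ⟨k, hk⟩ := E.owners_nonempty a
    exact absurd ⟨_, _, weaklyBlocks_single hE.1 ha hk⟩ hμ

end Economy

/-! ### The invariant of the algorithm. -/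

namespace YrmhState

variable {I : Type u} {O : Type v} {E : Economy I O} {r : O → I} {s t : YrmhState I O}

theorem highest_append {l₁ l₂ : List I} {S : Set I} {i : I} (hi : i ∈ l₁) (hiS : i ∈ S)
    (huniq : ∀ j ∈ l₁, j ∈ S → j = i) : highest (l₁ ++ l₂) S = some i := by
  classical
  unfold highest
  rw [List.find?_append]
  rcases h : l₁.find? (fun i => decide (i ∈ S)) with _ | j
  · have := List.find?_eq_none.mp h i hi
    simp [hiS] at this
  · have hj := List.find?_some h
    rw [huniq j (List.mem_of_find?_eq_some h) (by simpa using hj)]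
    rfl

theorem exists_highest {rk : List I} {S : Set I} (hrk : ∀ i, i ∈ rk) (hS : S.Nonempty) :
    ∃ i ∈ S, highest rk S = some i := by
  classical
  obtain ⟨j, hj⟩ := hS
  rcases h : highest rk S with _ | i
  · have := List.find?_eq_none.mp h j (hrk j)
    simp [hj] at this
  · have hi := List.find?_some h
    exact ⟨i, by simpa using hi, rfl⟩

/-- The invariant of the algorithm in economies without overlapping ownership: each remaining
object points to its representative `r o`, agents point to their favorites, ownership is never
shared, and the removed agents have traded in rounds. -/
structure Inv (E : Economy I O) (r : O → I) (s : YrmhState I O) : Prop where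
  ptr : ∀ o ∈ s.objs, s.ptr o = some (r o)
  rep_mem : ∀ o ∈ s.objs, r o ∈ s.order
  rep_notMem : ∀ o, o ∉ s.objs → r o ∉ s.order
  shared : ∀ o, s.shared o = ∅
  arc : ∀ i o, s.arc i = some o → o ∈ s.objs ∧ s.IsFavorite E i (some o)
  asg_rep : ∀ i, s.asg i ≠ none → ∃ o, i = r o
  rank : ∃ (ρ : O → ℕ) (n : ℕ), ∀ o, o ∉ s.objs → ρ o < n ∧
    (∃ o', o' ∉ s.objs ∧ s.asg (r o) = some o' ∧ ρ o' = ρ o) ∧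
    ∀ x, E.pref (r o) (some x) (s.asg (r o)) → x ∉ s.objs ∧ ρ x < ρ o

theorem Inv.start {rk : List I} (hrk : ∀ i, i ∈ rk)
    (hr : ∀ o, highest rk (E.owners o) = some (r o)) : Inv E r (start E rk) where
  ptr o _ := hr o
  rep_mem o _ := hrk _
  rep_notMem o ho := absurd (Set.mem_univ o) ho
  shared o := rfl
  arc i o h := by cases h
  asg_rep i h := absurd rfl h
  rank := ⟨fun _ => 0, 0, fun o ho => absurd (Set.mem_univ o) ho⟩

theorem IsFavorite.mem_objs {i : I} {o : O} (h : s.IsFavorite E i (some o)) : o ∈ s.objs := by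
  simpa using h.1

theorem IsFavorite.unique {i : I} {x y : Option O} (hx : s.IsFavorite E i x)
    (hy : s.IsFavorite E i y) : x = y := by
  rcases hx.2 y hy.1 with h | h
  · exact h
  · exact absurd h (Economy.weakPref.not_pref (hy.2 x hx.1))

theorem IsFavorite.objs_eq_empty (hA : E.AllAcceptable) {i : I}
    (h : s.IsFavorite E i none) : s.objs = ∅ := by
  refine Set.eq_empty_of_forall_notMem fun o ho => ?_
  exact (h.2 (some o) (Or.inl ⟨o, ho, rfl⟩)).not_pref (hA i o)

theorem Inv.requests_iff (h : Inv E r s) {k j : I} :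
    s.Requests k j ↔ ∃ o, s.arc k = some o ∧ j = r o := by
  refine exists_congr fun o => and_congr_right fun ho => ?_
  rw [h.ptr o (h.arc k o ho).1, Option.some_inj, eq_comm]

theorem point_arc_self (s : YrmhState I O) (i : I) (x : Option O) : (s.point i x).arc i = x := by
  classical
  simp [point]

theorem point_arc_of_ne (s : YrmhState I O) {i k : I} (x : Option O) (h : k ≠ i) :
    (s.point i x).arc k = s.arc k := by
  classical
  simp [point, h]

theorem Inv.point (h : Inv E r s) (rk : List I) {i : I} {x : Option O}
    (hx : s.IsFavorite E i x) : Inv E r ((s.repoint E rk).point i x) where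
  ptr o ho := by
    have hs := h.ptr o ho
    -- A remaining object points to a remaining agent, so it is never redirected.
    refine (if_neg ?_).trans hs
    rintro ⟨j, hj, hjs⟩
    rw [hs, Option.some_inj] at hj
    exact hjs (hj ▸ h.rep_mem o ho)
  rep_mem := h.rep_mem
  rep_notMem := h.rep_notMem
  shared := h.shared
  arc k o hk := by
    by_cases hki : k = i
    · subst hki
      rw [point_arc_self] at hk
      subst hk
      exact ⟨hx.mem_objs, hx⟩
    · rw [point_arc_of_ne _ _ hki] at hk
      exact h.arc k o hk
  asg_rep := h.asg_rep
  rank := h.rank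

theorem mem_moveTop_order {j k : I} (hj : j ∈ s.order) :
    k ∈ (s.moveTop j).order ↔ k ∈ s.order := by
  by_cases hk : k = j <;> simp [moveTop, hk, hj]

theorem Inv.moveTop (h : Inv E r s) {j : I} (hj : j ∈ s.order) : Inv E r (s.moveTop j) where
  ptr := h.ptr
  rep_mem o ho := (mem_moveTop_order hj).mpr (h.rep_mem o ho)
  rep_notMem o ho := fun hm => h.rep_notMem o ho ((mem_moveTop_order hj).mp hm)
  shared := h.shared
  arc := h.arc
  asg_rep := h.asg_rep
  rank := h.rank

theorem length_moveTop_le {j : I} (hj : j ∈ s.order) :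
    (s.moveTop j).order.length ≤ s.order.length := by
  classical
  -- The new order is a filtered list with one head added, so the weak bound is by definition the
  -- strict bound for the filtered list.
  exact List.length_filter_lt_length_iff_exists.mpr ⟨j, hj, by simp⟩

theorem length_clear_lt {K : Set I} {i : I} (hi : i ∈ s.order) (hK : i ∈ K) :
    (s.clear K).order.length < s.order.length := by
  classical
  exact List.length_filter_lt_length_iff_exists.mpr ⟨i, hi, by simp [hK]⟩

/-- The agents `K` trade along cycles: they are the representatives of their targets. -/
structure IsTrade (r : O → I) (s : YrmhState I O) (K : Set I) : Prop where
  mem_targets_iff : ∀ o, o ∈ s.targets K ↔ r o ∈ K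
  eq_rep : ∀ k ∈ K, ∃ o, k = r o
  exists_arc : ∀ k ∈ K, ∃ o, s.arc k = some o

/-- Each member of the cycle has a predecessor and a successor in it. The predecessor requests an
object represented by the member, and injectivity of `r` identifies that object. -/
theorem Inv.isTrade_cycle (h : Inv E r s) (hinj : Function.Injective r) {i : I}
    (hi : s.InCycle i) : IsTrade r s (s.cycle i) := by
  have hpred : ∀ k ∈ s.cycle i, ∃ m ∈ s.cycle i, ∃ o, s.arc m = some o ∧ k = r o := by
    rintro k ⟨hik, hki⟩
    obtain ⟨m, him, hmk⟩ := Relation.TransGen.tail'_iff.mp hik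
    refine ⟨m, ⟨?_, Relation.TransGen.head hmk hki⟩, h.requests_iff.mp hmk⟩
    rcases Relation.reflTransGen_iff_eq_or_transGen.mp him with heq | him
    · exact heq ▸ hi
    · exact him
  have hsucc : ∀ k ∈ s.cycle i, ∃ o, s.arc k = some o ∧ r o ∈ s.cycle i := by
    rintro k ⟨hik, hki⟩
    obtain ⟨m, hkm, hmi⟩ := Relation.TransGen.head'_iff.mp hki
    obtain ⟨o, ho, rfl⟩ := h.requests_iff.mp hkm
    refine ⟨o, ho, Relation.TransGen.tail hik hkm, ?_⟩
    rcases Relation.reflTransGen_iff_eq_or_transGen.mp hmi with heq | hmi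
    · exact heq ▸ hi
    · exact hmi
  refine ⟨fun o => ⟨?_, fun ho => ?_⟩, fun k hk => ?_, fun k hk => ?_⟩
  · rintro ⟨k, hk, hko⟩
    obtain ⟨o', ho', hr⟩ := hsucc k hk
    rw [hko, Option.some_inj] at ho'
    exact ho' ▸ hr
  · obtain ⟨m, hm, o', ho', hr⟩ := hpred _ ho
    exact ⟨m, hm, hinj hr ▸ ho'⟩
  · obtain ⟨m, -, o, -, hr⟩ := hpred k hk
    exact ⟨o, hr⟩
  · obtain ⟨o, ho, -⟩ := hsucc k hk
    exact ⟨o, ho⟩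

section Trade

variable {K : Set I}

theorem IsTrade.mem_objs (hK : IsTrade r s K) (h : Inv E r s) {o : O} (ho : r o ∈ K) :
    o ∈ s.objs := by
  obtain ⟨k, -, hk⟩ := (hK.mem_targets_iff o).mpr ho
  exact (h.arc k o hk).1

theorem IsTrade.mem_order (hK : IsTrade r s K) (h : Inv E r s) {k : I} (hk : k ∈ K) :
    k ∈ s.order := by
  obtain ⟨o, rfl⟩ := hK.eq_rep k hk
  exact h.rep_mem o (hK.mem_objs h hk)

/-- Ownership is not shared, because the members of the cycle own only objects of the cycle. -/
theorem IsTrade.share_eq (hK : IsTrade r s K) (h : Inv E r s) (hE : E.NoOverlappingOwnership)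
    (hr : ∀ o, r o ∈ E.owners o) : s.share E K = s := by
  have : (s.share E K).shared = s.shared := by
    funext a
    refine Set.union_eq_self_of_subset_right ?_
    rintro j' ⟨ha, -, ⟨j, hj, hja⟩, -⟩
    obtain ⟨b, rfl⟩ := hK.eq_rep j hj
    rcases hja with hja | hja
    · have hab := hE.eq_of_mem_owners hja.1 (hr b)
      subst hab
      exact absurd ((hK.mem_targets_iff a).mpr hj) ha.2
    · have := hja.1
      rw [h.shared a] at this
      cases this
  cases s
  simp only [share] at this ⊢
  rw [this]

theorem IsTrade.inv_clear (hK : IsTrade r s K) (h : Inv E r s) :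
    Inv E r (s.clear K) where
  ptr o ho := h.ptr o ho.1
  rep_mem o ho := by
    have := (hK.mem_targets_iff o).not.mp ho.2
    simpa [clear, this] using h.rep_mem o ho.1
  rep_notMem o ho := by
    intro hm
    obtain ⟨hm, hoK⟩ : r o ∈ s.order ∧ r o ∉ K := by simpa [clear] using hm
    have hos : o ∈ s.objs := by
      by_contra hos
      exact h.rep_notMem o hos hm
    exact ho ⟨hos, (hK.mem_targets_iff o).not.mpr hoK⟩
  shared := h.shared
  arc i o hi := by
    simp only [clear] at hi ⊢
    split_ifs at hi with hc
    have hos := h.arc i o hi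
    have hoT : o ∉ s.targets K := fun hoT => hc ⟨o, hoT, hi⟩
    refine ⟨⟨hos.1, hoT⟩, Or.inl ⟨o, ⟨hos.1, hoT⟩, rfl⟩, fun y hy => hos.2.2 y ?_⟩
    exact Set.union_subset_union_left _ (Set.image_mono Set.sdiff_subset) hy
  asg_rep i hi := by
    by_cases hiK : i ∈ K
    · exact hK.eq_rep i hiK
    · simp only [clear, if_neg hiK] at hi
      exact h.asg_rep i hi
  rank := by
    classical
    obtain ⟨ρ, n, hρ⟩ := h.rank
    have hT : ∀ o ∈ s.targets K, o ∈ s.objs := fun o ho =>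
      hK.mem_objs h ((hK.mem_targets_iff o).mp ho)
    have hold : ∀ x, x ∉ s.objs → x ∉ s.targets K := fun x hx hxT => hx (hT x hxT)
    -- The objects of the cycle form the new round `n`, above all earlier ranks. Anything better
    -- than a current favorite is already gone, hence of rank below `n`.
    refine ⟨fun o => if o ∈ s.targets K then n else ρ o, n + 1, fun o ho => ?_⟩
    by_cases hoT : o ∈ s.targets K
    · have hoK := (hK.mem_targets_iff o).mp hoT
      obtain ⟨o', ho'⟩ := hK.exists_arc _ hoK
      have hoT' : o' ∈ s.targets K := ⟨_, hoK, ho'⟩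
      simp only [clear, if_pos hoT, if_pos hoK]
      refine ⟨Nat.lt_succ_self n, ⟨o', fun hm => hm.2 hoT', ho', if_pos hoT'⟩, fun x hx => ?_⟩
      have hxs : x ∉ s.objs := by
        intro hxs
        rw [ho'] at hx
        exact ((h.arc _ _ ho').2.2 _ (Or.inl ⟨x, hxs, rfl⟩)).not_pref hx
      rw [if_neg (hold x hxs)]
      exact ⟨fun hm => hxs hm.1, (hρ x hxs).1⟩
    · have hos : o ∉ s.objs := fun hos => ho ⟨hos, hoT⟩
      have hoK := (hK.mem_targets_iff o).not.mp hoT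
      obtain ⟨h₁, ⟨o', ho', hasg, hρo'⟩, h₃⟩ := hρ o hos
      simp only [clear, if_neg hoT, if_neg hoK]
      refine ⟨h₁.trans (Nat.lt_succ_self n),
        ⟨o', fun hm => ho' hm.1, hasg, by rw [if_neg (hold o' ho'), hρo']⟩, fun x hx => ?_⟩
      obtain ⟨hxs, hlt⟩ := h₃ x hx
      rw [if_neg (hold x hxs)]
      exact ⟨fun hm => hxs hm.1, hlt⟩

end Trade

/-- With no objects left, all representatives are gone, so the remaining agent `i` is none of them
and the ranking is untouched. -/
theorem Inv.clear_singleton (h : Inv E r s) (hobjs : s.objs = ∅) {i : I} (hi : i ∈ s.order)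
    (harc : s.arc i = none) : Inv E r (s.clear {i}) := by
  have hobjs' : (s.clear {i}).objs = s.objs := by simp [clear, hobjs]
  have hasg : ∀ o, (s.clear {i}).asg (r o) = s.asg (r o) := by
    intro o
    refine if_neg fun ho => h.rep_notMem o (by simp [hobjs]) ?_
    rw [Set.mem_singleton_iff.mp ho]
    exact hi
  refine ⟨?_, ?_, ?_, h.shared, ?_, ?_, ?_⟩
  · simp [hobjs', hobjs]
  · simp [hobjs', hobjs]
  · intro o _ hm
    exact h.rep_notMem o (by simp [hobjs]) (List.mem_of_mem_filter hm)
  · intro k o hk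
    simp only [clear] at hk
    split_ifs at hk
    have := (h.arc k o hk).1
    simp [hobjs] at this
  · intro k hk
    by_cases hki : k ∈ ({i} : Set I)
    · rw [Set.mem_singleton_iff] at hki
      subst hki
      simp [clear, harc] at hk
    · simp only [clear, if_neg hki] at hk
      exact h.asg_rep k hk
  · simp only [hobjs', hasg]
    exact h.rank

theorem mem_of_head? {i : I} (hi : s.order.head? = some i) : i ∈ s.order :=
  List.mem_of_mem_head? hi

theorem Inv.step (hE : E.NoOverlappingOwnership) (hr : ∀ o, r o ∈ E.owners o) {rk : List I}
    (h : Inv E r s) (hst : Step E rk s t) : Inv E r t := by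
  cases hst with
  | takeNull i hi hx =>
    exact (h.point rk hx).clear_singleton (hx.objs_eq_empty hE.1) (mem_of_head? hi)
      (point_arc_self ..)
  | take i o hi hx ho =>
    have := (h.point rk hx).ptr o hx.mem_objs
    rw [show ((s.repoint E rk).point i (some o)).ptr o = none from ho] at this
    cases this
  | trade i o j t K hi hx ht ho hc hK =>
    subst ht hK
    have ht := h.point rk hx
    have hK := ht.isTrade_cycle (hE.rep_injective hr) hc
    rw [hK.share_eq ht hE hr]
    exact hK.inv_clear ht
  | move i o j t hi hx ht ho hc =>
    subst ht
    have ht := h.point rk hx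
    have hj := ht.ptr o hx.mem_objs
    rw [ho, Option.some_inj] at hj
    subst hj
    exact ht.moveTop (ht.rep_mem o hx.mem_objs)

theorem Inv.steps (hE : E.NoOverlappingOwnership) (hr : ∀ o, r o ∈ E.owners o) {rk : List I}
    (h : Inv E r s) (hst : Relation.ReflTransGen (Step E rk) s t) : Inv E r t := by
  induction hst with
  | refl => exact h
  | tail _ hst ih => exact ih.step hE hr hst

theorem Inv.exists_isTopTrading (hr : ∀ o, r o ∈ E.owners o) (h : Inv E r s)
    (hs : s.order = []) {μ : Allocation I O} (hμ : ∀ i, μ.get i = s.asg i) :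
    ∃ ρ, E.IsTopTrading μ r ρ := by
  have hobjs : ∀ o, o ∉ s.objs := fun o ho => by
    have := h.rep_mem o ho
    simp [hs] at this
  obtain ⟨ρ, n, hρ⟩ := h.rank
  refine ⟨ρ, hr, fun i hi => h.asg_rep i (hμ i ▸ hi), fun o => ?_, fun o x hx => ?_⟩
  · obtain ⟨o', -, ho', hρo⟩ := (hρ o (hobjs o)).2.1
    exact ⟨o', (hμ _).trans ho', hρo⟩
  · rw [hμ] at hx
    exact ((hρ o (hobjs o)).2.2 x hx).2

/-! ### Termination -/

/-- From every state with remaining agents, the algorithm goes on to remove an agent. The set `V`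
consists of agents from whom the highest agent can be reached. -/
theorem Inv.exists_removal [Finite I] [Finite O] (rk : List I) (n : ℕ) (V : Set I) (s : YrmhState I O)
    (h : Inv E r s) (hs : s.order ≠ []) (hn : Vᶜ.ncard = n)
    (hV : ∀ i, s.order.head? = some i → ∀ v ∈ V, Relation.TransGen s.Requests v i) :
    ∃ t, Relation.ReflTransGen (Step E rk) s t ∧ t.order.length < s.order.length := by
  induction n using Nat.strong_induction_on generalizing V s with
  | _ n ih =>
    obtain ⟨i, hi⟩ := Option.ne_none_iff_exists'.mp (List.head?_eq_none_iff.not.mpr hs)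
    have his := mem_of_head? hi
    obtain ⟨x, hx⟩ : ∃ x, s.IsFavorite E i x :=
      Economy.exists_favorite E i (S := some '' s.objs ∪ {none}) ⟨none, Or.inr rfl⟩
    rcases x with _ | o
    · exact ⟨_, .single (Step.takeNull i hi hx), length_clear_lt his rfl⟩
    have ht := h.point rk hx
    have hptr := ht.ptr o hx.mem_objs
    by_cases hc : ((s.repoint E rk).point i (some o)).InCycle i
    · exact ⟨_, .single (Step.trade i o _ _ _ hi hx rfl hptr hc rfl),
        length_clear_lt (s := ((s.repoint E rk).point i (some o)).share E _) his ⟨hc, hc⟩⟩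
    -- An arc that `i` already had leads to the same unique favorite, so pointing again destroys no
    -- request.
    have hmono : ∀ a b, s.Requests a b →
        ((s.repoint E rk).point i (some o)).Requests a b := by
      intro a b hab
      obtain ⟨o', ho', hb⟩ := h.requests_iff.mp hab
      refine ht.requests_iff.mpr ⟨o', ?_, hb⟩
      by_cases hai : a = i
      · subst hai
        rw [(h.arc a o' ho').2.unique hx]
        exact point_arc_self ..
      · exact (point_arc_of_ne _ _ hai).trans ho'
    have hVt := fun v hv => (hV i hi v hv).lift id hmono
    -- If `i` were in `V`, she would reach herself and a cycle would exist. So `V` strictly grows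
    -- with each move, which bounds the number of moves.
    have hiV : i ∉ V := fun hiV => hc (hVt i hiV)
    have hro : r o ∈ ((s.repoint E rk).point i (some o)).order := ht.rep_mem o hx.mem_objs
    have hreq : ((s.repoint E rk).point i (some o)).Requests i (r o) :=
      ⟨o, point_arc_self .., hptr⟩
    obtain ⟨t, hst, hlt⟩ := ih (insert i V)ᶜ.ncard
      (hn ▸ Set.ncard_lt_ncard
        (compl_lt_compl_iff_lt.mpr (Set.ssubset_insert hiV)) (Set.toFinite _))
      (insert i V) _ (ht.moveTop hro) (List.cons_ne_nil _ _) rfl (by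
        intro k hk v hv
        have hk : r o = k := Option.some_inj.mp hk
        subst hk
        rcases hv with rfl | hv
        · exact .single hreq
        · exact (hVt v hv).tail hreq)
    exact ⟨t, .head (Step.move i o _ _ hi hx rfl hptr hc) hst,
      hlt.trans_le (length_moveTop_le hro)⟩

theorem Inv.exists_run [Finite I] [Finite O] (hE : E.NoOverlappingOwnership)
    (hr : ∀ o, r o ∈ E.owners o) (rk : List I) (n : ℕ) (s : YrmhState I O) (h : Inv E r s)
    (hn : s.order.length = n) :
    ∃ t, Relation.ReflTransGen (Step E rk) s t ∧ t.order = [] := by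
  induction n using Nat.strong_induction_on generalizing s with
  | _ n ih =>
    by_cases hs : s.order = []
    · exact ⟨s, .refl, hs⟩
    obtain ⟨t, hst, hlt⟩ := h.exists_removal rk _ ∅ s hs rfl (by simp)
    obtain ⟨t', ht', he⟩ := ih _ (hn ▸ hlt) t (h.steps hE hr hst) rfl
    exact ⟨t', hst.trans ht', he⟩

/-! ### Strong core allocations are reached -/

/-- The removed agents have obtained their assignments in `μ`. -/
def Agrees (μ : Allocation I O) (s : YrmhState I O) : Prop :=
  ∀ i, i ∉ s.order → s.asg i = μ.get i

/-- In `μ` the removed objects circulate among their own removed representatives, so by counting no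
remaining agent receives one. -/
theorem Inv.mem_objs_of_agrees [Finite O] {μ : Allocation I O} (hinj : Function.Injective r)
    (h : Inv E r s) (ha : s.Agrees μ) {i : I} {x : O} (hi : i ∈ s.order)
    (hx : μ.get i = some x) : x ∈ s.objs := by
  by_contra hxs
  obtain ⟨ρ, n, hρ⟩ := h.rank
  obtain ⟨y, hy, rfl⟩ := μ.eq_rep_of_closed hinj (S := s.objsᶜ) (fun y hy => by
    obtain ⟨z, hz, hasg, -⟩ := (hρ y hy).2.1
    exact ⟨z, hz, (ha _ (h.rep_notMem y hy)).symm.trans hasg⟩) hxs hx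
  exact h.rep_notMem y hy hi

/-- Members of the cycle get their favorites among objects that include their assignments in `μ`. If
one of them differs, all owners of the objects in the cycle form a weak block; the owners off the
cycle receive nothing either way. -/
theorem IsTrade.arc_eq [Finite O] {K : Set I} {μ : Allocation I O}
    (hE : E.NoOverlappingOwnership)
    (hμ : μ ∈ E.strongCore) (hr : ∀ o, r o ∈ E.owners o)
    (hrep : ∀ i, μ.get i ≠ none → ∃ o, i = r o) (hK : IsTrade r s K) (h : Inv E r s)
    (ha : s.Agrees μ) {k : I} (hk : k ∈ K) : s.arc k = μ.get k := by
  classical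
  have hinj := hE.rep_injective hr
  by_contra hne
  have hT : ∀ o : s.targets K, ∃ o' : s.targets K, s.arc (r o) = some o'.1 := by
    rintro ⟨o, ho⟩
    have hoK := (hK.mem_targets_iff o).mp ho
    obtain ⟨o', ho'⟩ := hK.exists_arc _ hoK
    exact ⟨⟨o', _, hoK, ho'⟩, ho'⟩
  choose f hf using hT
  -- By finiteness this makes `f` injective, so no two members of the cycle request the same object
  -- and `σ` is an allocation.
  have hsurj : Function.Surjective f := by
    rintro ⟨o, k, hk, hko⟩
    obtain ⟨y, rfl⟩ := hK.eq_rep k hk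
    refine ⟨⟨y, (hK.mem_targets_iff y).mpr hk⟩, Subtype.ext ?_⟩
    exact Option.some_inj.mp ((hf _).symm.trans hko)
  have hfinj := Finite.injective_iff_surjective.mpr hsurj
  let σ : Allocation I O :=
    { get := fun i => if i ∈ K then s.arc i else none
      get_inj := by
        intro i j o hi hj
        split_ifs at hi hj with hiK hjK
        obtain ⟨a, rfl⟩ := hK.eq_rep i hiK
        obtain ⟨b, rfl⟩ := hK.eq_rep j hjK
        have haf := hf ⟨a, (hK.mem_targets_iff a).mpr hiK⟩
        have hbf := hf ⟨b, (hK.mem_targets_iff b).mpr hjK⟩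
        have hab := Subtype.ext (Option.some_inj.mp
          (haf.symm.trans (hi.trans (hj.symm.trans hbf))))
        exact congrArg (fun o => r o.1) (hfinj hab) }
  have hσ : ∀ i ∈ K, σ.get i = s.arc i := fun i hi => if_pos hi
  have hw : ∀ i ∈ K, E.weakPref i (s.arc i) (μ.get i) := by
    intro i hi
    obtain ⟨o, ho⟩ := hK.exists_arc i hi
    rw [ho]
    refine (h.arc i o ho).2.2 _ ?_
    rcases hx : μ.get i with _ | x
    · exact Or.inr rfl
    · exact Or.inl ⟨x, h.mem_objs_of_agrees hinj ha (hK.mem_order h hi) hx, rfl⟩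
  have hKC : ∀ i ∈ K, i ∈ {i | ∃ o, r o ∈ K ∧ i ∈ E.owners o} := by
    intro i hi
    obtain ⟨o, rfl⟩ := hK.eq_rep i hi
    exact ⟨o, hi, hr o⟩
  refine hμ ⟨{i | ∃ o, r o ∈ K ∧ i ∈ E.owners o}, σ, ⟨k, hKC k hk⟩,
    ⟨?_, k, hKC k hk, ?_⟩, ?_⟩
  · rintro i ⟨o, ho, hio⟩
    by_cases hi : i ∈ K
    · rw [hσ i hi]
      exact hw i hi
    · left
      rw [show σ.get i = none from if_neg hi]
      by_contra hne
      obtain ⟨y, rfl⟩ := hrep i (Ne.symm hne)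
      exact hi (hE.eq_of_mem_owners (hr y) hio ▸ ho)
  · rw [hσ k hk]
    exact (hw k hk).pref_of_ne hne
  · rw [Economy.selfEnforcing_iff]
    intro i _ o ho
    by_cases hi : i ∈ K
    · rw [hσ i hi] at ho
      exact fun j hj => ⟨o, (hK.mem_targets_iff o).mp ⟨i, hi, ho⟩, hj⟩
    · rw [show σ.get i = none from if_neg hi] at ho
      cases ho

theorem Agrees.clear {μ : Allocation I O} {K : Set I} (ha : s.Agrees μ)
    (hK : ∀ k ∈ K, s.arc k = μ.get k) : (s.clear K).Agrees μ := by
  intro i hi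
  by_cases hiK : i ∈ K
  · exact (if_pos hiK).trans (hK i hiK)
  · exact (if_neg hiK).trans (ha i fun hm => hi (by simpa [YrmhState.clear, hiK] using hm))

theorem Agrees.step [Finite O] {μ : Allocation I O} (hE : E.NoOverlappingOwnership)
    (hμ : μ ∈ E.strongCore) (hr : ∀ o, r o ∈ E.owners o)
    (hrep : ∀ i, μ.get i ≠ none → ∃ o, i = r o) {rk : List I} (h : Inv E r s)
    (ha : s.Agrees μ) (hst : Step E rk s t) : t.Agrees μ := by
  cases hst with
  | takeNull i hi hx =>
    refine Agrees.clear (s := (s.repoint E rk).point i none) ha ?_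
    rintro _ rfl
    refine (point_arc_self ..).trans ?_
    rcases hx' : μ.get _ with _ | x
    · rfl
    · have := h.mem_objs_of_agrees (hE.rep_injective hr) ha (mem_of_head? hi) hx'
      rw [hx.objs_eq_empty hE.1] at this
      cases this
  | take i o hi hx ho =>
    have := (h.point rk hx).ptr o hx.mem_objs
    rw [show ((s.repoint E rk).point i (some o)).ptr o = none from ho] at this
    cases this
  | trade i o j t K hi hx ht ho hc hK =>
    subst ht hK
    have ht := h.point rk hx
    have hK := ht.isTrade_cycle (hE.rep_injective hr) hc
    rw [hK.share_eq ht hE hr]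
    have ha' : ((s.repoint E rk).point i (some o)).Agrees μ := ha
    exact ha'.clear fun k hk => hK.arc_eq hE hμ hr hrep ht ha' hk
  | move i o j t hi hx ht ho hc =>
    subst ht
    have ht := h.point rk hx
    have hj := ht.ptr o hx.mem_objs
    rw [ho, Option.some_inj] at hj
    subst hj
    exact fun k hk => ha k fun hm =>
      hk ((mem_moveTop_order (ht.rep_mem o hx.mem_objs)).mpr hm)

end YrmhState

/-! ### Outcomes of the algorithm are the strong core. -/

namespace Economy

variable {I : Type u} {O : Type v} {E : Economy I O}

theorem exists_isTopTrading_of_mem_yrmhOutcomes (hE : E.NoOverlappingOwnership)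
    {μ : Allocation I O} (hμ : μ ∈ E.yrmhOutcomes) : ∃ r ρ, E.IsTopTrading μ r ρ := by
  obtain ⟨rk, -, hrk, s, hst, hs, hget⟩ := hμ
  choose r hr hhigh using fun o => YrmhState.exists_highest hrk (E.owners_nonempty o)
  exact ⟨r, ((YrmhState.Inv.start hrk hhigh).steps hE hr hst).exists_isTopTrading hr hs hget⟩

theorem strongCore_subset_yrmhOutcomes [Finite I] [Finite O] (hE : E.NoOverlappingOwnership) :
    E.strongCore ⊆ E.yrmhOutcomes := by
  classical
  intro μ hμ
  obtain ⟨r, hr, -, hrep⟩ := exists_rep_of_mem_strongCore hE hμ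
  have := Fintype.ofFinite I
  let p : I → Bool := fun i => decide (i ∈ Set.range r)
  let L : List I := Finset.univ.toList
  have hL : ∀ i, i ∈ L := fun i => Finset.mem_toList.mpr (Finset.mem_univ i)
  -- Ranking the agents who represent objects in `μ` first makes each `r o` the highest owner of
  -- `o`.
  let rk : List I := L.filter p ++ L.filter (fun i => !p i)
  have hperm : rk.Perm L := List.filter_append_perm p L
  have hrk : ∀ i, i ∈ rk := fun i => hperm.mem_iff.mpr (hL i)
  have hhigh : ∀ o, YrmhState.highest rk (E.owners o) = some (r o) := by
    intro o
    refine YrmhState.highest_append (List.mem_filter.mpr ⟨hL _, by simp [p]⟩) (hr o) ?_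
    intro j hj hjo
    obtain ⟨y, rfl⟩ : j ∈ Set.range r := by simpa [p] using (List.mem_filter.mp hj).2
    rw [hE.eq_of_mem_owners (hr y) hjo]
  have hinv := YrmhState.Inv.start hrk hhigh
  obtain ⟨s, hst, hs⟩ := hinv.exists_run hE hr rk _ _ rfl
  have hag : s.Agrees μ := by
    clear hs
    induction hst with
    | refl => exact fun i hi => absurd (hrk i) hi
    | tail hst hstep ih => exact ih.step hE hμ hr hrep (hinv.steps hE hr hst) hstep
  exact ⟨rk, hperm.nodup_iff.mpr (Finset.nodup_toList _), hrk, s, hst, hs,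
    fun i => (hag i (by simp [hs])).symm⟩

theorem yrmhOutcomes_eq_strongCore [Finite I] [Finite O] (hE : E.NoOverlappingOwnership) :
    E.yrmhOutcomes = E.strongCore := by
  refine Set.Subset.antisymm (fun μ hμ => ?_) (strongCore_subset_yrmhOutcomes hE)
  obtain ⟨r, ρ, h⟩ := exists_isTopTrading_of_mem_yrmhOutcomes hE hμ
  exact fun ⟨C, σ, hb⟩ => h.not_weaklyBlocks hE C σ hb

theorem strongCore_subset_refinedExclusionCore [Finite I] [Finite O]
    (hE : E.NoOverlappingOwnership) : E.strongCore ⊆ E.refinedExclusionCore := by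
  intro μ hμ
  obtain ⟨r, ρ, h⟩ :=
    exists_isTopTrading_of_mem_yrmhOutcomes hE (strongCore_subset_yrmhOutcomes hE hμ)
  exact fun ⟨C, σ, hb⟩ => h.not_refinedExclusionBlocks hE C σ hb

end Economy

theorem proposition2 {I : Type u} {O : Type v} [Finite I] [Finite O] (E : Economy I O)
    (hE : E.NoOverlappingOwnership) :
    E.yrmhOutcomes = E.strongCore ∧
    E.strongCore = E.rectifiedCore ∧
    E.rectifiedCore = E.refinedExclusionCore ∧
    E.refinedExclusionCore ⊆ E.exclusionCore :=
  ⟨Economy.yrmhOutcomes_eq_strongCore hE, Economy.strongCore_eq_rectifiedCore hE,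
    (Economy.strongCore_eq_rectifiedCore hE).symm.trans
      ((Economy.strongCore_subset_refinedExclusionCore hE).antisymm
        (Economy.refinedExclusionCore_subset_strongCore hE)),
    Economy.refinedExclusionCore_subset_exclusionCore⟩
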